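/- Let $n\ge 1$, let $\mathbb{C}^n$ carry the Euclidean inner product and norm, let $B^n$ be the open unit ball, and let $A:\mathbb{C}^n\to\mathbb{C}^n$ be linear with $m(A):=\min\{\Re\langle Az,z\rangle:\|z\|=1\}>0$. Put $k_+(A):=\max\{\Re\lambda:\lambda\in\sigma(A)\}$ and $n_0:=\lfloor k_+(A)/m(A)\rfloor$. Let $h:B^n\times[0,\infty)\to\mathbb{C}^n$ be such that, for each $t\ge 0$, $h(\cdot,t)$ is holomorphic on $B^n$ with $Dh(0,t)=A$ and $\Re\langle h(z,t),z\rangle>0$ for $z\in B^n\setminus\{0\}$, and, for each $z\in B^n$, $h(z,\cdot)$ is measurable on $[0,\infty)$. For $z\in B^n$ and $s\ge 0$ let $v(z,s,\cdot):[s,\infty)\to B^n$ be the locally absolutely continuous solution of $$\frac{\partial v}{\partial t}(z,s,t)=-h(v(z,s,t),t)\ \text{ for a.e. } t\ge s,\qquad v(z,s,s)=z.$$ Let $f:B^n\times[0,\infty)\to\mathbb{C}^n$ be a solution of the Loewner chain equation $$\frac{\partial f}{\partial t}(z,t)=Df(z,t)\,h(z,t)\quad\text{for a.e. } t\ge 0,\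 z\in B^n,$$ where $f(\cdot,t)$ is holomorphic on $B^n$ for every $t\geq 0$ and $f(z,\cdot)$ is locally absolutely continuous on $[0,\infty)$, locally uniformly with respect to $z\in B^n$. Assume that $f$ is polynomially bounded, i.e. for every compact $K\subset B^n$ there are a constant $C_K$ and a polynomial $P$ with $\|e^{-tA}f(z,t)\|\le C_K P(t)$ for all $z\in K$, $t\ge 0$, and that $$f(z,t)=e^{tA}\Big(z+\sum_{k=2}^{\infty}F_k(z^k,t)\Big),\qquad z\in B^n,\ t\ge 0,$$ where, for each $t$ and $k$, $F_k(\cdot,t)$ is a $k$-linear map $(\mathbb{C}^n)^k\to\mathbb{C}^n$ and $F_k(z^k,t):=F_k(z,\dots,z,t)$ is the associated homogeneous polynomial mapping of degree $k$. Then for every $s\ge 0$ $$f(z,s)=\lim_{t\to\infty}e^{tA}\Big(v(z,s,t)+\sum_{k=2}^{n_0}F_k\big(v(z,s,t)^k,t\big)\Big),$$ and the limit is locally uniform in $z\in B^n$. -/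

import Mathlib

open Set Filter Topology MeasureTheory Metric

noncomputable section

namespace Loewner

/-- `ℂⁿ` with its Euclidean norm and inner product. -/
abbrev Cn (n : ℕ) : Type := EuclideanSpace ℂ (Fin n)

variable {n : ℕ}

/-- The open Euclidean unit ball `Bⁿ`. -/
abbrev unitBall (n : ℕ) : Set (Cn n) := ball 0 1

/-- `m(A) = min {Re ⟨A z, z⟩ : ‖z‖ = 1}`. The minimum is attained when `n ≥ 1`; for `n = 0` the
value is `0`, so `0 < lowerIndex A` forces `n ≥ 1`. -/
def lowerIndex (A : Cn n →L[ℂ] Cn n) : ℝ :=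
  sInf ((fun z : Cn n => (inner ℂ (A z) z).re) '' sphere 0 1)

/-- `k₊(A) = max {Re λ : λ ∈ σ(A)}`. -/
def upperIndex (A : Cn n →L[ℂ] Cn n) : ℝ :=
  sSup (Complex.re '' spectrum ℂ A)

/-- `n₀ = [k₊(A) / m(A)]` (integer part). -/
def criticalOrder (A : Cn n →L[ℂ] Cn n) : ℕ :=
  ⌊upperIndex A / lowerIndex A⌋₊

/-- The linear map `e^{tA}`. -/
def expA (A : Cn n →L[ℂ] Cn n) (t : ℝ) : Cn n →L[ℂ] Cn n :=
  NormedSpace.exp ((t : ℂ) • A)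

/-- The class `𝓝_A`: holomorphic `g : Bⁿ → ℂⁿ` with `Dg(0) = A` and `Re ⟨g(z), z⟩ > 0` for
`z ≠ 0`. -/
structure MemNA (A : Cn n →L[ℂ] Cn n) (g : Cn n → Cn n) : Prop where
  holo : DifferentiableOn ℂ g (unitBall n)
  re_pos : ∀ z ∈ unitBall n, z ≠ 0 → 0 < (inner ℂ (g z) z).re
  deriv_zero : HasFDerivAt g A 0

/-- The class `𝓗_A(Bⁿ)` of infinitesimal generators `h(z,t)`, `z ∈ Bⁿ`, `t ≥ 0`. The values of `h`
at other arguments play no role. -/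
structure IsGenerator (A : Cn n →L[ℂ] Cn n) (h : Cn n → ℝ → Cn n) : Prop where
  mem : ∀ t, 0 ≤ t → MemNA A (fun z => h z t)
  meas : ∀ z ∈ unitBall n, AEMeasurable (fun t => h z t) (volume.restrict (Ici 0))

/-- `f(z,·)` is locally absolutely continuous on `[0,∞)`, locally uniformly in `z ∈ Bⁿ`: on every
`[0,T]` and every compact `K ⊆ Bⁿ`, the `δ` in the definition of absolute continuity can be chosen
the same for all `z ∈ K`. (`disjWithin 0 T` is Mathlib's set of finite families of pairwise
disjoint intervals with endpoints in `[0,T]`.) -/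
def LocallyUniformlyAC (f : Cn n → ℝ → Cn n) : Prop :=
  ∀ K ⊆ unitBall n, IsCompact K → ∀ T > (0 : ℝ), ∀ ε > (0 : ℝ), ∃ δ > (0 : ℝ), ∀ z ∈ K,
    ∀ I ∈ AbsolutelyContinuousOnInterval.disjWithin 0 T,
      ∑ i ∈ Finset.range I.1, dist (I.2 i).1 (I.2 i).2 < δ →
      ∑ i ∈ Finset.range I.1, dist (f z (I.2 i).1) (f z (I.2 i).2) < ε

/-- `f : Bⁿ × [0,∞) → ℂⁿ` is a solution of the Loewner chain equation
`∂f/∂t (z,t) = Df(z,t) h(z,t)`, a.e. `t ≥ 0`, `z ∈ Bⁿ`: holomorphic in `z`, locally absolutely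
continuous in `t` locally uniformly in `z`. The exceptional null set is allowed to depend on `z`. -/
structure IsLoewnerSolution (h f : Cn n → ℝ → Cn n) : Prop where
  holo : ∀ t, 0 ≤ t → DifferentiableOn ℂ (fun z => f z t) (unitBall n)
  ac : LocallyUniformlyAC f
  eqn : ∀ z ∈ unitBall n, ∀ᵐ t ∂(volume.restrict (Ici (0 : ℝ))),
    HasDerivAt (fun τ => f z τ) (fderiv ℂ (fun w => f w t) z (h z t)) t

/-- `v(z,s,t)`, `z ∈ Bⁿ`, `0 ≤ s ≤ t`, is the (Carathéodory) solution in `Bⁿ` of the initial value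
problem `∂v/∂t = -h(v,t)` a.e. `t ≥ s`, `v(z,s,s) = z`. -/
structure IsTransitionMap (h : Cn n → ℝ → Cn n) (v : Cn n → ℝ → ℝ → Cn n) : Prop where
  mem_ball : ∀ z ∈ unitBall n, ∀ s t, 0 ≤ s → s ≤ t → v z s t ∈ unitBall n
  init : ∀ z ∈ unitBall n, ∀ s, 0 ≤ s → v z s s = z
  ac : ∀ z ∈ unitBall n, ∀ s T, 0 ≤ s → s ≤ T →
    AbsolutelyContinuousOnInterval (fun t => v z s t) s T
  eqn : ∀ z ∈ unitBall n, ∀ s, 0 ≤ s → ∀ᵐ t ∂(volume.restrict (Ici s)),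
    HasDerivAt (fun τ => v z s τ) (-(h (v z s t) t)) t

/-- `{e^{-tA} f(·,t)}_{t ≥ 0}` is locally polynomially bounded on `Bⁿ`. -/
def PolynomiallyBounded (A : Cn n →L[ℂ] Cn n) (f : Cn n → ℝ → Cn n) : Prop :=
  ∀ K ⊆ unitBall n, IsCompact K → ∃ (C : ℝ) (P : Polynomial ℝ), ∀ z ∈ K, ∀ t, 0 ≤ t →
    ‖expA A (-t) (f z t)‖ ≤ C * P.eval t

/-- `f(z,t) = e^{tA} (z + ∑_{k ≥ 2} F_k(z^k, t))` on `Bⁿ × [0,∞)`, where `F_k(z^k, t)` is the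
homogeneous polynomial of degree `k` obtained by evaluating the `k`-linear map `F_k(·,t)` at
`(z,…,z)`. -/
def HasExpansion (A : Cn n →L[ℂ] Cn n) (f : Cn n → ℝ → Cn n)
    (F : (k : ℕ) → ℝ → ContinuousMultilinearMap ℂ (fun _ : Fin k => Cn n) (Cn n)) : Prop :=
  ∀ z ∈ unitBall n, ∀ t, 0 ≤ t →
    Summable (fun k : ℕ => F (k + 2) t (fun _ => z)) ∧
      f z t = expA A t (z + ∑' k : ℕ, F (k + 2) t (fun _ => z))

end Loewner

end

open Loewner

/-! The chain is constant along the transition mappings: `f (v z s t) t = f z s`. The error of the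
approximation is therefore `expA A t` applied to the tail, of degree above $n_0$, of the expansion
of $e^{-tA}f(\cdot,t)$ at the point $v(z,s,t)$. Three growth rates compete.

The tail at $w$ is at most $2M(t)(2\|w\|)^{n_0+1}$, where $M(t)$ bounds $e^{-tA}f(\cdot,t)$ on the
ball of radius $1/2$ and grows polynomially (`norm_tail_le`). The transition mappings decay like
$e^{-m(A)(t-s)}$, uniformly for $\|z\|\le r<1$ (`IsTransitionMap.norm_le_exp`). For every
$\kappa>k_+(A)$, $\|e^{tA}\|=O(e^{\kappa t})$ (`exists_norm_expA_le`). Since $k_+(A)<m(A)(n_0+1)$,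
$\kappa$ can be taken strictly between, and the error is a polynomial times a decaying exponential.

The delicate point is constancy along $v$ (`IsLoewnerSolution.apply_transition`): the null set where
the Loewner equation fails depends on $z$, so the equation cannot be evaluated directly at the
moving point $v(z,s,t)$. It is used on a countable dense set of points and carried to the curve by
Lipschitz bounds on the increments of `f`, which follow from Cauchy estimates and from a bound on
$h$ uniform in time (`MemNA.norm_le`). -/

namespace Loewner

/-! ### Absolutely continuous functions with a derivative bound almost everywhere -/

section AbsolutelyContinuous

variable {X Y E : Type*} [PseudoMetricSpace X] [PseudoMetricSpace Y]
  [NormedAddCommGroup E] [NormedSpace ℝ E]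

/-- The sums of increments of `φ` are dominated by those of `v` and of the identity. The term in `M`
allows an explicit time dependence, as in `τ ↦ f (v τ) τ`. -/
theorem absolutelyContinuousOnInterval_of_dist_le {v : ℝ → X} {φ : ℝ → Y} {a b L M : ℝ}
    (hv : AbsolutelyContinuousOnInterval v a b)
    (hφ : ∀ x ∈ uIcc a b, ∀ y ∈ uIcc a b,
      dist (φ x) (φ y) ≤ L * dist (v x) (v y) + M * dist x y) :
    AbsolutelyContinuousOnInterval φ a b := by
  have hid : AbsolutelyContinuousOnInterval (fun x : ℝ => x) a b :=
    (LipschitzWith.id.lipschitzOnWith (s := uIcc a b)).absolutelyContinuousOnInterval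
  unfold AbsolutelyContinuousOnInterval at hv hid ⊢
  refine squeeze_zero' ?_ ?_ (by simpa using (hv.const_mul L).add (hid.const_mul M))
  · exact Eventually.of_forall fun _ => Finset.sum_nonneg fun i hi => dist_nonneg
  rw [eventually_inf_principal]
  filter_upwards with I hI
  simp only [Finset.mul_sum, ← Finset.sum_add_distrib]
  exact Finset.sum_le_sum fun i hi => hφ _ (hI.1 i hi).1 _ (hI.1 i hi).2

theorem le_of_ae_hasDerivAt_nonpos {g : ℝ → ℝ} {a b : ℝ} (hab : a ≤ b)
    (hg : AbsolutelyContinuousOnInterval g a b)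
    (hd : ∀ᵐ t, t ∈ Icc a b → ∃ d ≤ 0, HasDerivAt g d t) : g b ≤ g a := by
  have h1 := hg.integral_deriv_eq_sub
  have h2 : 0 ≤ ∫ x in a..b, -deriv g x := by
    refine intervalIntegral.integral_nonneg_of_ae_restrict hab ?_
    rw [EventuallyLE, ae_restrict_iff' measurableSet_Icc]
    filter_upwards [hd] with t ht hmem
    obtain ⟨d, hd0, hd1⟩ := ht hmem
    simpa [hd1.deriv] using hd0
  rw [intervalIntegral.integral_neg] at h2
  linarith

/-- A norming functional of `g b - g a` reduces this to the scalar case. -/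
theorem dist_le_of_ae_hasDerivAt_norm_le {g : ℝ → E} {a b M : ℝ} (hab : a ≤ b)
    (hg : AbsolutelyContinuousOnInterval g a b)
    (hd : ∀ᵐ t, t ∈ Icc a b → ∃ d, ‖d‖ ≤ M ∧ HasDerivAt g d t) :
    ‖g b - g a‖ ≤ M * (b - a) := by
  obtain ⟨l, hl, hl'⟩ := exists_dual_vector'' ℝ (g b - g a)
  have key := le_of_ae_hasDerivAt_nonpos (g := fun t => l (g t) - M * t) hab
    (absolutelyContinuousOnInterval_of_dist_le (L := 1) (M := |M|) hg ?_) ?_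
  · have : l (g b) - l (g a) = ‖g b - g a‖ := by rw [← map_sub]; simpa using hl'
    linarith
  · intro x _ y _
    rw [Real.dist_eq]
    have : (l (g x) - M * x) - (l (g y) - M * y) = l (g x - g y) - M * (x - y) := by
      rw [map_sub]; ring
    rw [this, dist_eq_norm, Real.dist_eq]
    refine (abs_sub _ _).trans (add_le_add ?_ (abs_mul _ _).le)
    exact (l.le_opNorm _).trans (by gcongr)
  · filter_upwards [hd] with t ht hmem
    obtain ⟨d, hdM, hd1⟩ := ht hmem
    refine ⟨l d - M * 1, ?_, (l.hasFDerivAt.comp_hasDerivAt t hd1).sub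
      ((hasDerivAt_id t).const_mul M)⟩
    have := (le_abs_self _).trans ((l.le_opNorm d).trans (mul_le_mul_of_nonneg_right hl
      (norm_nonneg d)))
    linarith

end AbsolutelyContinuous

variable {n : ℕ}

/-! ### Growth estimates for the class $\mathcal N_A$ -/

section Caratheodory

/-- Harnack's inequality, from the Schwarz lemma for the Cayley transform
$(p-p(0))/(p+\overline{p(0)})$, which maps the disc into the unit disc. -/
theorem re_lower_bound_of_re_pos {p : ℂ → ℂ} (hp : DifferentiableOn ℂ p (ball 0 1))
    (hre : ∀ ζ ∈ ball (0 : ℂ) 1, 0 < (p ζ).re) {ζ : ℂ} (hζ : ‖ζ‖ < 1) :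
    (p 0).re * (1 - ‖ζ‖) ≤ (p ζ).re * (1 + ‖ζ‖) := by
  have h0 := hre 0 (by simp)
  have hne : ∀ w ∈ ball (0 : ℂ) 1, p w + star (p 0) ≠ 0 := fun w hw h => by
    have := congrArg Complex.re h
    simp at this
    linarith [hre w hw]
  have hsq : ∀ w, ‖p w - p 0‖ ^ 2 = ((p w).re - (p 0).re) ^ 2 + ((p w).im - (p 0).im) ^ 2 := by
    intro w
    rw [← Complex.normSq_eq_norm_sq, Complex.normSq_apply]
    simp; ring
  have hsq' : ∀ w, ‖p w + star (p 0)‖ ^ 2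
      = ((p w).re + (p 0).re) ^ 2 + ((p w).im - (p 0).im) ^ 2 := by
    intro w
    rw [← Complex.normSq_eq_norm_sq, Complex.normSq_apply]
    simp; ring
  have key : ‖(p ζ - p 0) / (p ζ + star (p 0))‖ ≤ ‖ζ‖ := by
    refine Complex.norm_le_norm_of_mapsTo_ball (R := 1)
      (f := fun ζ => (p ζ - p 0) / (p ζ + star (p 0))) ?_ ?_ (by simp) hζ
    · exact (hp.sub_const _).div (hp.add_const _) hne
    · intro w hw
      have := hre w hw
      rw [mem_closedBall_zero_iff, norm_div, div_le_one (norm_pos_iff.2 (hne w hw))]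
      rw [← sq_le_sq₀ (norm_nonneg _) (norm_nonneg _), hsq, hsq']
      nlinarith
  have hζ' : ζ ∈ ball (0 : ℂ) 1 := by simpa using hζ
  rw [norm_div, div_le_iff₀ (norm_pos_iff.2 (hne ζ hζ')),
    ← sq_le_sq₀ (norm_nonneg _) (by positivity), mul_pow, hsq, hsq'] at key
  have hx := hre ζ hζ'
  have hr := norm_nonneg ζ
  -- The imaginary parts contribute the same square to both sides of `key`, with factor
  -- $|\zeta|^2\le 1$ on the right, so they can be dropped.
  have h2 : ((p 0).re - (p ζ).re) ^ 2 ≤ (‖ζ‖ * ((p ζ).re + (p 0).re)) ^ 2 := by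
    have : ‖ζ‖ ^ 2 * ((p ζ).im - (p 0).im) ^ 2 ≤ 1 * ((p ζ).im - (p 0).im) ^ 2 := by
      gcongr; exact pow_le_one₀ hr hζ.le
    nlinarith
  have := abs_le_of_sq_le_sq' h2 (by positivity)
  linarith [this.2]

theorem exists_unit_smul {z : Cn n} (hz : z ≠ 0) : ∃ u : Cn n, ‖u‖ = 1 ∧ z = (‖z‖ : ℂ) • u := by
  have hz' : 0 < ‖z‖ := norm_pos_iff.2 hz
  refine ⟨(‖z‖⁻¹ : ℂ) • z, by rw [norm_smul]; simp [hz'.ne'], ?_⟩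
  rw [smul_smul, mul_inv_cancel₀ (by exact_mod_cast hz'.ne'), one_smul]

theorem lowerIndex_mul_norm_sq_le (A : Cn n →L[ℂ] Cn n) (z : Cn n) :
    lowerIndex A * ‖z‖ ^ 2 ≤ (inner ℂ (A z) z).re := by
  rcases eq_or_ne z 0 with rfl | hz
  · simp
  obtain ⟨u, hu1, hzu⟩ := exists_unit_smul hz
  have h1 : lowerIndex A ≤ (inner ℂ (A u) u).re := by
    refine csInf_le ⟨-‖A‖, ?_⟩ ⟨u, by simpa using hu1, rfl⟩
    rintro _ ⟨w, hw, rfl⟩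
    have hw1 : ‖w‖ = 1 := by simpa using hw
    have h3 := (Complex.abs_re_le_norm (inner ℂ (A w) w)).trans (norm_inner_le_norm _ _)
    have h4 := A.le_opNorm w
    rw [hw1, mul_one] at h3 h4
    exact (abs_le.1 (h3.trans h4)).1
  have h2 : (inner ℂ (A z) z).re = ‖z‖ ^ 2 * (inner ℂ (A u) u).re := by
    conv_lhs => rw [hzu]
    rw [map_smul, inner_smul_left, inner_smul_right]
    simp only [Complex.conj_ofReal]
    rw [← mul_assoc, ← Complex.ofReal_mul, Complex.re_ofReal_mul, sq]
  rw [h2, mul_comm]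
  gcongr

variable {A : Cn n →L[ℂ] Cn n} {g : Cn n → Cn n}

/-- Otherwise, at $z=-\varepsilon g(0)$ the quantity $\Re\langle g(z),z\rangle$ is close to
$-\varepsilon\|g(0)\|^2<0$. -/
theorem MemNA.map_zero (hg : MemNA A g) : g 0 = 0 := by
  by_contra hne
  have hc : Tendsto (fun ε : ℝ => (inner ℂ (g ((-ε : ℂ) • g 0)) (-(g 0))).re) (𝓝[>] 0)
      (𝓝 (inner ℂ (g 0) (-(g 0))).re) := by
    have h1 : Tendsto (fun ε : ℝ => (-ε : ℂ) • g 0) (𝓝[>] 0) (𝓝 0) := by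
      have : Continuous (fun ε : ℝ => (-ε : ℂ) • g 0) := by fun_prop
      have := (this.tendsto 0).mono_left (nhdsWithin_le_nhds (s := Ioi 0))
      simpa using this
    have h2 := hg.deriv_zero.continuousAt.tendsto.comp h1
    exact (Complex.continuous_re.tendsto _).comp (h2.inner tendsto_const_nhds)
  have hneg : (inner ℂ (g 0) (-(g 0))).re < 0 := by
    rw [inner_neg_right, inner_self_eq_norm_sq_to_K]
    have : 0 < ‖g 0‖ := norm_pos_iff.2 hne
    have h3 : 0 < ‖g 0‖ ^ 2 := by positivity
    simpa [← Complex.ofReal_pow] using h3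
  have h4 : ∀ᶠ ε : ℝ in 𝓝[>] 0, (-ε : ℂ) • g 0 ∈ unitBall n := by
    have : Continuous (fun ε : ℝ => (-ε : ℂ) • g 0) := by fun_prop
    refine ((this.tendsto 0).mono_left (nhdsWithin_le_nhds (s := Ioi 0))).eventually ?_
    rw [Complex.ofReal_zero, neg_zero, zero_smul]
    exact ball_mem_nhds (0 : Cn n) one_pos
  obtain ⟨ε, hε1, hε2, hε3⟩ :=
    ((hc.eventually (gt_mem_nhds hneg)).and (h4.and self_mem_nhdsWithin)).exists
  have hε3 : (0 : ℝ) < ε := hε3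
  have h5 := hg.re_pos _ hε2 (by simp [hne, hε3.ne'])
  have h6 : (inner ℂ (g ((-ε : ℂ) • g 0)) ((-ε : ℂ) • g 0)).re
      = ε * (inner ℂ (g ((-ε : ℂ) • g 0)) (-(g 0))).re := by
    rw [neg_smul, ← smul_neg, inner_smul_right, Complex.re_ofReal_mul]
  rw [h6] at h5
  nlinarith

/-- On each complex line through the origin, `⟨g, ·⟩` is `|ζ|²` times a function with positive real
part. -/
theorem MemNA.exists_slice (hA : 0 < lowerIndex A) (hg : MemNA A g) {u : Cn n} (hu : ‖u‖ = 1) :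
    ∃ p : ℂ → ℂ, DifferentiableOn ℂ p (ball 0 1) ∧ (∀ ζ ∈ ball (0 : ℂ) 1, 0 < (p ζ).re) ∧
      p 0 = inner ℂ u (A u) ∧
      ∀ ζ ∈ ball (0 : ℂ) 1, inner ℂ (ζ • u) (g (ζ • u)) = (‖ζ‖ ^ 2 : ℝ) * p ζ := by
  have hline : ∀ ζ ∈ ball (0 : ℂ) 1, ζ • u ∈ unitBall n := fun ζ hζ => by
    simpa [norm_smul, hu] using hζ
  set G : ℂ → ℂ := fun ζ => inner ℂ u (g (ζ • u)) with hG
  have hGd : DifferentiableOn ℂ G (ball 0 1) := by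
    have h1 : DifferentiableOn ℂ (fun ζ : ℂ => g (ζ • u)) (ball 0 1) :=
      hg.holo.comp (by fun_prop) hline
    exact ((innerSL ℂ u).differentiable.comp_differentiableOn h1)
  have hG0 : G 0 = 0 := by simp [hG, hg.map_zero]
  have hG' : HasDerivAt G (inner ℂ u (A u)) 0 := by
    have h1 : HasDerivAt (fun ζ : ℂ => ζ • u) u 0 := by
      simpa using (hasDerivAt_id (0 : ℂ)).smul_const u
    have h2 : HasDerivAt (fun ζ : ℂ => g (ζ • u)) (A u) 0 :=
      HasFDerivAt.comp_hasDerivAt (l := g) (l' := A) (0 : ℂ) (by simpa using hg.deriv_zero) h1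
    exact (innerSL ℂ u).hasFDerivAt.comp_hasDerivAt 0 h2
  have hmul : ∀ ζ : ℂ, G ζ = ζ * dslope G 0 ζ := fun ζ => by
    have := sub_smul_dslope G 0 ζ
    simp only [sub_zero, hG0, smul_eq_mul] at this
    exact this.symm
  have hval : ∀ ζ : ℂ, inner ℂ (ζ • u) (g (ζ • u)) = (‖ζ‖ ^ 2 : ℝ) * dslope G 0 ζ := fun ζ => by
    rw [inner_smul_left]
    change _ * G ζ = _
    rw [hmul, ← mul_assoc, mul_comm _ ζ, Complex.mul_conj, Complex.normSq_eq_norm_sq]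
  have hp0 : dslope G 0 0 = inner ℂ u (A u) := by rw [dslope_same, hG'.deriv]
  refine ⟨dslope G 0, (Complex.differentiableOn_dslope (ball_mem_nhds _ one_pos)).2 hGd, ?_, hp0,
    fun ζ _ => hval ζ⟩
  intro ζ hζ
  rcases eq_or_ne ζ 0 with rfl | hne
  · have h1 := lowerIndex_mul_norm_sq_le A u
    rw [hp0, ← inner_conj_symm, Complex.conj_re]
    rw [hu] at h1
    linarith
  · have h1 := hg.re_pos _ (hline ζ hζ) (by
      intro h0; rcases smul_eq_zero.1 h0 with h | h
      · exact hne h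
      · simp [h] at hu)
    rw [← inner_conj_symm, Complex.conj_re, hval, Complex.re_ofReal_mul] at h1
    exact pos_of_mul_pos_right h1 (by positivity)

/-- Harnack's inequality on the slice through `z`, whose value at the origin has real part at least
$m(A)$. -/
theorem MemNA.re_inner_ge (hA : 0 < lowerIndex A) (hg : MemNA A g) {z : Cn n}
    (hz : z ∈ unitBall n) :
    lowerIndex A * ‖z‖ ^ 2 * (1 - ‖z‖) ≤ (inner ℂ (g z) z).re * (1 + ‖z‖) := by
  rcases eq_or_ne z 0 with rfl | hz0
  · simp
  obtain ⟨u, hu, hzu⟩ := exists_unit_smul hz0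
  obtain ⟨p, hp, hpos, hp0, hpv⟩ := hg.exists_slice hA hu
  have hz1 : ‖z‖ < 1 := by simpa using hz
  have hn : ‖(‖z‖ : ℂ)‖ = ‖z‖ := by simp
  have h1 := re_lower_bound_of_re_pos hp hpos (ζ := (‖z‖ : ℂ)) (by rwa [hn])
  have h2 := hpv (‖z‖ : ℂ) (by simpa using hz1)
  rw [← hzu, hn] at h2
  have h3 : (inner ℂ (g z) z).re = ‖z‖ ^ 2 * (p ‖z‖).re := by
    rw [← inner_conj_symm, Complex.conj_re, h2, Complex.re_ofReal_mul]
  have h4 := lowerIndex_mul_norm_sq_le A u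
  rw [hu, ← inner_conj_symm, Complex.conj_re, ← hp0] at h4
  rw [hn] at h1
  rw [h3]
  have h5 : lowerIndex A * (1 - ‖z‖) ≤ (p ‖z‖).re * (1 + ‖z‖) :=
    le_trans (mul_le_mul_of_nonneg_right (by linarith) (by linarith)) h1
  calc _ = ‖z‖ ^ 2 * (lowerIndex A * (1 - ‖z‖)) := by ring
    _ ≤ ‖z‖ ^ 2 * ((p ‖z‖).re * (1 + ‖z‖)) := by gcongr
    _ = _ := by ring

theorem MemNA.norm_inner_le (hA : 0 < lowerIndex A) (hg : MemNA A g) {z : Cn n} {r : ℝ}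
    (hr : r < 1) (hz : ‖z‖ ≤ r) : ‖inner ℂ z (g z)‖ ≤ (2 + 2 * ‖A‖) / (1 - r) := by
  have hr1 : 0 < 1 - r := by linarith
  rcases eq_or_ne z 0 with rfl | hz0
  · simp; positivity
  obtain ⟨u, hu, hzu⟩ := exists_unit_smul hz0
  obtain ⟨p, hp, hpos, hp0, hpv⟩ := hg.exists_slice hA hu
  have hz1 : ‖z‖ < 1 := by linarith
  have hn : ‖(‖z‖ : ℂ)‖ = ‖z‖ := by simp
  have hmem : (‖z‖ : ℂ) ∈ ball (0 : ℂ) 1 := by simpa using hz1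
  have h2 := hpv (‖z‖ : ℂ) hmem
  rw [← hzu, hn] at h2
  -- The real part of $-p$ is negative, so $1$ serves as its upper bound.
  have h1 := Complex.borelCaratheodory (f := fun ζ => -p ζ) one_pos hp.neg
    (fun ζ hζ => by have := hpos ζ hζ; simp; linarith) one_pos hmem
  rw [norm_neg, norm_neg, hn] at h1
  have h3 : ‖p 0‖ ≤ ‖A‖ := by
    rw [hp0]
    refine (norm_inner_le_norm _ _).trans ?_
    simpa [hu] using A.le_opNorm u
  have hz2 : 0 < 1 - ‖z‖ := by linarith
  rw [h2, norm_mul, Complex.norm_real, Real.norm_of_nonneg (by positivity)]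
  calc ‖z‖ ^ 2 * ‖p ‖z‖‖ ≤ 1 * ‖p ‖z‖‖ := by
        gcongr; exact pow_le_one₀ (norm_nonneg _) hz1.le
    _ ≤ (2 * ‖z‖ + ‖p 0‖ * (1 + ‖z‖)) / (1 - ‖z‖) := by rw [add_div]; linarith
    _ ≤ (2 + 2 * ‖A‖) / (1 - ‖z‖) := by
        refine div_le_div_of_nonneg_right ?_ hz2.le
        nlinarith [norm_nonneg A, norm_nonneg z, norm_nonneg (p 0)]
    _ ≤ _ := by gcongr

/-- Mappings in the class `𝓝_A` are bounded on each smaller ball, uniformly over the class. -/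
theorem MemNA.norm_le (hA : 0 < lowerIndex A) (hg : MemNA A g) {z : Cn n} {r : ℝ}
    (hr : r < 1) (hz : ‖z‖ ≤ r) : ‖g z‖ ≤ (2 + 2 * ‖A‖) / ((1 - r) / 2) / ((1 - r) / 2) := by
  have hr1 : 0 < 1 - r := by linarith
  -- Half the gap to the unit sphere: $1-(r+\rho)=\rho$.
  set ρ := (1 - r) / 2 with hρ
  have hρ0 : 0 < ρ := by positivity
  rcases eq_or_ne (g z) 0 with h0 | h0
  · rw [h0, norm_zero]; positivity
  obtain ⟨w, hw, hgw⟩ := exists_unit_smul h0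
  have hline : ∀ ζ ∈ closedBall (0 : ℂ) ρ, ‖z + ζ • w‖ ≤ r + ρ := fun ζ hζ => by
    refine (norm_add_le _ _).trans (add_le_add hz ?_)
    simpa [norm_smul, hw] using hζ
  -- On $|\zeta|=\rho$ one has $\zeta\bar\zeta=\rho^2$, so $\psi(\zeta)=\zeta\langle z+\zeta
  -- w,g(z+\zeta w)\rangle$, which `MemNA.norm_inner_le` controls. Unlike that expression, $\psi$ is
  -- holomorphic, and $\psi(0)=\rho^2\|g(z)\|$; the maximum principle concludes.
  set ψ : ℂ → ℂ := fun ζ =>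
    ζ * inner ℂ z (g (z + ζ • w)) + (ρ ^ 2 : ℝ) * inner ℂ w (g (z + ζ • w)) with hψ
  have hrρ : r + ρ < 1 := by rw [hρ]; linarith
  have hψd : DifferentiableOn ℂ ψ (closedBall 0 ρ) := by
    have h1 : DifferentiableOn ℂ (fun ζ : ℂ => g (z + ζ • w)) (closedBall 0 ρ) :=
      hg.holo.comp (by fun_prop) (fun ζ hζ => by
        have := hline ζ hζ
        simp only [mem_ball, dist_zero_right]; linarith)
    exact (differentiableOn_id.mul
      ((innerSL ℂ z).differentiable.comp_differentiableOn h1)).add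
      (((innerSL ℂ w).differentiable.comp_differentiableOn h1).const_mul _)
  have hbd : ∀ ζ ∈ frontier (ball (0 : ℂ) ρ), ‖ψ ζ‖ ≤ ρ * ((2 + 2 * ‖A‖) / ρ) := by
    intro ζ hζ
    rw [frontier_ball _ hρ0.ne'] at hζ
    have hζn : ‖ζ‖ = ρ := by simpa using hζ
    have h2 : ψ ζ = ζ * inner ℂ (z + ζ • w) (g (z + ζ • w)) := by
      rw [inner_add_left, inner_smul_left, mul_add, ← mul_assoc ζ (starRingEnd ℂ ζ),
        Complex.mul_conj, Complex.normSq_eq_norm_sq, hζn]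
    rw [h2, norm_mul, hζn]
    gcongr
    have := hg.norm_inner_le hA hrρ (hline ζ (sphere_subset_closedBall hζ))
    have h3 : 1 - (r + ρ) = ρ := by rw [hρ]; ring
    rwa [h3] at this
  have h4 := Complex.norm_le_of_forall_mem_frontier_norm_le (f := ψ) isBounded_ball
    (DifferentiableOn.diffContOnCl (by rwa [closure_ball _ hρ0.ne'])) hbd
    (subset_closure (mem_ball_self hρ0))
  have h5 : ψ 0 = (ρ ^ 2 * ‖g z‖ : ℝ) := by
    simp only [hψ, zero_mul, zero_smul, add_zero, zero_add]
    conv_lhs => rw [hgw]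
    rw [inner_smul_right, inner_self_eq_norm_sq_to_K, hw]
    simp
  rw [h5, Complex.norm_real, Real.norm_of_nonneg (by positivity)] at h4
  rw [le_div_iff₀ hρ0]
  nlinarith

end Caratheodory

/-! ### Decay of the transition mappings -/

section Decay

variable {A : Cn n →L[ℂ] Cn n} {h : Cn n → ℝ → Cn n} {v : Cn n → ℝ → ℝ → Cn n}

/-- Integrating factor argument for `‖v(z,s,·)‖²`. -/
theorem IsTransitionMap.norm_sq_mul_exp_le (hv : IsTransitionMap h v) {z : Cn n}
    (hz : z ∈ unitBall n) {s T : ℝ} (hs : 0 ≤ s) (hsT : s ≤ T) {a E : ℝ → ℝ}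
    (hE : ∀ t, HasDerivAt E (a t) t) (ha : Continuous a)
    (hle : ∀ t ∈ Icc s T, a t * ‖v z s t‖ ^ 2 ≤ 2 * (inner ℂ (h (v z s t) t) (v z s t)).re) :
    ‖v z s T‖ ^ 2 * Real.exp (E T) ≤ ‖z‖ ^ 2 * Real.exp (E s) := by
  have hac := hv.ac z hz s T hs hsT
  have hac2 : AbsolutelyContinuousOnInterval (fun t => ‖v z s t‖ ^ 2) s T := by
    refine absolutelyContinuousOnInterval_of_dist_le (L := 2) (M := 0) hac fun x hx y hy => ?_
    rw [uIcc_of_le hsT] at hx hy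
    have hx1 : ‖v z s x‖ < 1 := by simpa using hv.mem_ball z hz s x hs hx.1
    have hy1 : ‖v z s y‖ < 1 := by simpa using hv.mem_ball z hz s y hs hy.1
    rw [Real.dist_eq, sq_sub_sq, abs_mul, dist_eq_norm, zero_mul, add_zero]
    refine mul_le_mul ?_ (abs_norm_sub_norm_le _ _) (abs_nonneg _) (by norm_num)
    rw [abs_of_nonneg (by positivity)]
    linarith
  have hE1 : ContDiff ℝ 1 E := contDiff_one_iff_deriv.2
    ⟨fun t => (hE t).differentiableAt, by rwa [show deriv E = a from funext fun t => (hE t).deriv]⟩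
  have hacE : AbsolutelyContinuousOnInterval (fun t => Real.exp (E t)) s T :=
    (hE1.exp).contDiffOn.absolutelyContinuousOnInterval
  have key := le_of_ae_hasDerivAt_nonpos hsT (hac2.fun_mul hacE) ?_
  · simpa [hv.init z hz s hs] using key
  have h1 := hv.eqn z hz s hs
  rw [ae_restrict_iff' measurableSet_Ici] at h1
  filter_upwards [h1] with t ht hmem
  have hd := ht hmem.1
  have h2 : HasDerivAt (fun τ => ‖v z s τ‖ ^ 2)
      (-(2 * (inner ℂ (h (v z s t) t) (v z s t)).re)) t := by
    have h3 := Complex.reCLM.hasFDerivAt.comp_hasDerivAt t (hd.inner ℂ hd)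
    have e1 : (fun τ => ‖v z s τ‖ ^ 2) = Complex.reCLM ∘ fun t => inner ℂ (v z s t) (v z s t) := by
      ext τ
      rw [Function.comp_apply, inner_self_eq_norm_sq_to_K]
      simp [← Complex.ofReal_pow]
    have e2 : -(2 * (inner ℂ (h (v z s t) t) (v z s t)).re) = Complex.reCLM
        (inner ℂ (v z s t) (-h (v z s t) t) + inner ℂ (-h (v z s t) t) (v z s t)) := by
      rw [inner_neg_right, inner_neg_left, ← inner_conj_symm (v z s t), Complex.reCLM_apply,
        Complex.add_re, Complex.neg_re, Complex.neg_re, Complex.conj_re]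
      ring
    rw [e1, e2]
    exact h3
  refine ⟨_, ?_, h2.mul (hE t).exp⟩
  have := hle t hmem
  have h4 := Real.exp_pos (E t)
  nlinarith

theorem IsTransitionMap.norm_le (hv : IsTransitionMap h v) (hA : 0 < lowerIndex A)
    (hh : IsGenerator A h) {z : Cn n} (hz : z ∈ unitBall n) {s t : ℝ} (hs : 0 ≤ s)
    (hst : s ≤ t) : ‖v z s t‖ ≤ ‖z‖ := by
  have := hv.norm_sq_mul_exp_le hz hs hst (a := fun _ => 0) (E := fun _ => 0)
    (fun t => hasDerivAt_const t 0) continuous_const (fun τ hτ => ?_)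
  · simp only [Real.exp_zero, mul_one] at this
    exact le_of_sq_le_sq this (norm_nonneg _)
  · have hb := hv.mem_ball z hz s τ hs hτ.1
    have h1 := (hh.mem τ (hs.trans hτ.1)).re_inner_ge hA hb
    have h2 : ‖v z s τ‖ < 1 := by simpa using hb
    have h3 : 0 ≤ lowerIndex A * ‖v z s τ‖ ^ 2 * (1 - ‖v z s τ‖) :=
      mul_nonneg (by positivity) (by linarith)
    have := nonneg_of_mul_nonneg_left (h3.trans h1) (by positivity)
    simpa using this

/-- Exponential decay of the transition mappings with the sharp rate `m(A)`. -/
theorem IsTransitionMap.norm_le_exp (hv : IsTransitionMap h v) (hA : 0 < lowerIndex A)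
    (hh : IsGenerator A h) {z : Cn n} {r : ℝ} (hr : r < 1) (hz : ‖z‖ ≤ r) {s t : ℝ} (hs : 0 ≤ s)
    (hst : s ≤ t) :
    ‖v z s t‖ ≤ Real.exp (2 / ((1 - r) / (1 + r))) * Real.exp (-(lowerIndex A * (t - s))) := by
  set m := lowerIndex A
  have hz1 : z ∈ unitBall n := by simpa using hz.trans_lt hr
  have hr0 : 0 ≤ r := (norm_nonneg z).trans hz
  set c := (1 - r) / (1 + r) with hc
  have hc0 : 0 < c := div_pos (by linarith) (by linarith)
  have hgen : ∀ τ, s ≤ τ → ∀ x, ‖v z s τ‖ ≤ x → x < 1 →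
      2 * m * ((1 - x) / (1 + x)) * ‖v z s τ‖ ^ 2 ≤
        2 * (inner ℂ (h (v z s τ) τ) (v z s τ)).re := by
    intro τ hτ x hx hx1
    have hx0 : 0 ≤ x := (norm_nonneg _).trans hx
    have h1 := (hh.mem τ (hs.trans hτ)).re_inner_ge hA (hv.mem_ball z hz1 s τ hs hτ)
    have h2 : (1 - x) / (1 + x) ≤ (1 - ‖v z s τ‖) / (1 + ‖v z s τ‖) := by
      rw [div_le_div_iff₀ (by positivity) (by positivity)]
      nlinarith
    have h3 : m * ‖v z s τ‖ ^ 2 * ((1 - ‖v z s τ‖) / (1 + ‖v z s τ‖)) ≤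
        (inner ℂ (h (v z s τ) τ) (v z s τ)).re := by
      rw [← mul_div_assoc, div_le_iff₀ (by positivity)]
      exact h1
    have h4 : m * ‖v z s τ‖ ^ 2 * ((1 - x) / (1 + x)) ≤
        m * ‖v z s τ‖ ^ 2 * ((1 - ‖v z s τ‖) / (1 + ‖v z s τ‖)) := by gcongr
    linarith
  -- Crude decay, with rate $mc$ instead of $m$: only $\|v\|\le r$ is used.
  have hfirst : ∀ τ, s ≤ τ → ‖v z s τ‖ ≤ Real.exp (-(m * c * (τ - s))) := by
    intro τ hτ
    have := hv.norm_sq_mul_exp_le hz1 hs hτ (a := fun _ => 2 * m * c)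
      (E := fun t => 2 * m * c * (t - s))
      (fun t => by simpa using ((hasDerivAt_id t).sub_const s).const_mul (2 * m * c))
      continuous_const
      (fun σ hσ => hgen σ hσ.1 r ((hv.norm_le hA hh hz1 hs hσ.1).trans hz) hr)
    simp only [sub_self, mul_zero, Real.exp_zero, mul_one] at this
    have h1 : ‖z‖ ^ 2 ≤ 1 := pow_le_one₀ (norm_nonneg _) (hz.trans hr.le)
    have h2 : (‖v z s τ‖ * Real.exp (m * c * (τ - s))) ^ 2 ≤ 1 := by
      rw [mul_pow, ← Real.exp_nat_mul]
      refine le_trans (le_of_eq ?_) (this.trans h1)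
      congr 2; push_cast; ring
    have h3 : ‖v z s τ‖ * Real.exp (m * c * (τ - s)) ≤ 1 := by
      exact (sq_le_one_iff₀ (by positivity)).1 h2
    rw [Real.exp_neg, ← one_div, le_div_iff₀ (Real.exp_pos _)]
    exact h3
  -- Bootstrap: $(1-x)/(1+x)\ge 1-2x$ with $x=\|v\|$, and `hfirst` makes the loss $2x$ integrable in
  -- time. The total loss $4/c$ only affects the constant, so the full rate $m$ is recovered.
  have hsecond := hv.norm_sq_mul_exp_le hz1 hs hst
    (a := fun t => 2 * m * (1 - 2 * Real.exp (-(m * c * (t - s)))))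
    (E := fun t => 2 * m * (t - s) + 4 / c * Real.exp (-(m * c * (t - s))))
    (fun t => by
      have h1 := ((hasDerivAt_id t).sub_const s).const_mul (2 * m)
      have h2 := ((((hasDerivAt_id t).sub_const s).const_mul (m * c)).neg.exp).const_mul (4 / c)
      refine (h1.add h2).congr_deriv ?_
      simp only [id, Pi.neg_apply]
      field_simp
      ring)
    (by fun_prop)
    (fun τ hτ => by
      refine le_trans ?_ (hgen τ hτ.1 _ le_rfl (by simpa using hv.mem_ball z hz1 s τ hs hτ.1))
      gcongr
      rw [le_div_iff₀ (by positivity)]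
      have h1 := hfirst τ hτ.1
      nlinarith [norm_nonneg (v z s τ)])
  simp only [sub_self, mul_zero, neg_zero, Real.exp_zero, mul_one, zero_add] at hsecond
  have h1 : ‖z‖ ^ 2 ≤ 1 := pow_le_one₀ (norm_nonneg _) (hz.trans hr.le)
  have h2 : ‖v z s t‖ ^ 2 * Real.exp (2 * m * (t - s)) ≤ Real.exp (4 / c) := by
    refine le_trans ?_ (hsecond.trans (mul_le_of_le_one_left (Real.exp_pos _).le h1))
    gcongr
    have : 0 ≤ 4 / c * Real.exp (-(m * c * (t - s))) := by positivity
    linarith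
  refine le_of_sq_le_sq ?_ (by positivity)
  rw [← Real.exp_add, ← Real.exp_nat_mul]
  have h3 : ((2 : ℕ) : ℝ) * (2 / c + -(m * (t - s))) = 4 / c - 2 * m * (t - s) := by
    push_cast; ring
  rw [h3, Real.exp_sub, le_div_iff₀ (Real.exp_pos _)]
  exact h2

end Decay

/-! ### Cauchy estimates on balls -/

section Invariance

theorem mapsTo_closedBall_of_norm_le {g : Cn n → Cn n} {R r B : ℝ}
    (hB : ∀ x ∈ ball (0 : Cn n) R, ‖g x‖ ≤ B) (hrR : r < R) {x : Cn n} (hx : ‖x‖ ≤ r) :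
    ball x (R - r) ⊆ ball 0 R ∧ MapsTo g (ball x (R - r)) (closedBall (g x) (2 * B)) := by
  have hsub : ball x (R - r) ⊆ ball 0 R :=
    ball_subset_ball' (by rw [dist_zero_right]; linarith)
  refine ⟨hsub, fun y hy => ?_⟩
  rw [mem_closedBall, dist_eq_norm]
  have h1 := hB y (hsub hy)
  have h2 := hB x (by rw [mem_ball_zero_iff]; linarith)
  linarith [norm_sub_le (g y) (g x)]

theorem norm_fderiv_le_of_norm_le {g : Cn n → Cn n} {R r B : ℝ}
    (hg : DifferentiableOn ℂ g (ball 0 R)) (hB : ∀ x ∈ ball (0 : Cn n) R, ‖g x‖ ≤ B)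
    (hrR : r < R) {x : Cn n} (hx : ‖x‖ ≤ r) : ‖fderiv ℂ g x‖ ≤ 2 * B / (R - r) := by
  obtain ⟨hsub, hmaps⟩ := mapsTo_closedBall_of_norm_le hB hrR hx
  exact Complex.norm_fderiv_le_div_of_mapsTo_ball (hg.mono hsub) hmaps (by linarith)

theorem norm_sub_le_of_norm_le {g : Cn n → Cn n} {R r B : ℝ}
    (hg : DifferentiableOn ℂ g (ball 0 R)) (hB : ∀ x ∈ ball (0 : Cn n) R, ‖g x‖ ≤ B)
    (hrR : r < R) {x y : Cn n} (hx : ‖x‖ ≤ r) (hy : ‖y‖ ≤ r) :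
    ‖g x - g y‖ ≤ 2 * B / (R - r) * ‖x - y‖ := by
  have hopen : ∀ w ∈ closedBall (0 : Cn n) r, w ∈ ball (0 : Cn n) R := fun w hw => by
    rw [mem_closedBall_zero_iff] at hw; rw [mem_ball_zero_iff]; linarith
  refine Convex.norm_image_sub_le_of_norm_fderiv_le (𝕜 := ℂ) (s := closedBall (0 : Cn n) r)
    (fun w hw => hg.differentiableAt (isOpen_ball.mem_nhds (hopen w hw)))
    (fun w hw => norm_fderiv_le_of_norm_le hg hB hrR (by simpa using hw))
    (convex_closedBall _ _) (by simpa using hy) (by simpa using hx)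

/-- The Cauchy estimate is applied to the difference of `g` and a translate of `g`, which is small
because `g` is locally Lipschitz. -/
theorem continuousAt_fderiv {g : Cn n → Cn n} (hg : DifferentiableOn ℂ g (unitBall n)) {x : Cn n}
    (hx : x ∈ unitBall n) : ContinuousAt (fderiv ℂ g) x := by
  have hx1 : ‖x‖ < 1 := by simpa using hx
  set r := (1 + ‖x‖) / 2 with hr
  set R := (1 + r) / 2 with hR
  have hR1 : R < 1 := by rw [hR, hr]; linarith
  have hrR : r < R := by rw [hR, hr]; linarith
  obtain ⟨B, hB⟩ := (isCompact_closedBall (0 : Cn n) R).exists_bound_of_continuousOn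
    (hg.continuousOn.mono (closedBall_subset_ball hR1))
  set K := 2 * B / (R - r)
  have hK : ∀ a b : Cn n, ‖a‖ ≤ r → ‖b‖ ≤ r → ‖g a - g b‖ ≤ K * ‖a - b‖ := fun a b ha hb =>
    norm_sub_le_of_norm_le (hg.mono (ball_subset_ball hR1.le))
      (fun w hw => hB w (ball_subset_closedBall hw)) hrR ha hb
  -- Chosen so that the ball of radius `δ` about `x`, translated by less than `δ`, stays within norm
  -- $\|x\|+2\delta=r$.
  set δ := (1 - ‖x‖) / 4 with hδ
  have hδ0 : 0 < δ := by rw [hδ]; linarith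
  have hδr : ‖x‖ + δ + δ = r := by rw [hδ, hr]; ring
  have hest : ∀ y ∈ ball x δ, ‖fderiv ℂ g y - fderiv ℂ g x‖ ≤ 2 * (K * ‖y - x‖) / δ := by
    intro y hy
    have hyx : ‖y - x‖ < δ := by rwa [mem_ball, dist_eq_norm] at hy
    have hw1 : ∀ w ∈ ball x δ, ‖w‖ ≤ ‖x‖ + δ := fun w hw => by
      rw [mem_ball, dist_eq_norm] at hw
      linarith [norm_le_norm_add_norm_sub' w x]
    have hw2 : ∀ w ∈ ball x δ, ‖w + (y - x)‖ ≤ r := fun w hw => by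
      linarith [hw1 w hw, norm_add_le w (y - x)]
    have hmem : ∀ w : Cn n, ‖w‖ ≤ r → w ∈ unitBall n := fun w hw => by
      rw [mem_ball_zero_iff]; linarith
    set G : Cn n → Cn n := fun w => g (w + (y - x)) - g w with hG
    have hGd : DifferentiableOn ℂ G (ball x δ) :=
      (hg.comp (by fun_prop) fun w hw => hmem _ (hw2 w hw)).sub
        (hg.mono fun w hw => hmem w (by linarith [hw1 w hw]))
    have hGb : ∀ w ∈ ball x δ, ‖G w‖ ≤ K * ‖y - x‖ := fun w hw => by
      have := hK _ w (hw2 w hw) (by linarith [hw1 w hw])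
      rwa [add_sub_cancel_left] at this
    have hGm : MapsTo G (ball x δ) (closedBall (G x) (2 * (K * ‖y - x‖))) := fun w hw => by
      rw [mem_closedBall, dist_eq_norm]
      linarith [hGb w hw, hGb x (mem_ball_self hδ0), norm_sub_le (G w) (G x)]
    have h1 := Complex.norm_fderiv_le_div_of_mapsTo_ball hGd hGm hδ0
    have hgy : HasFDerivAt g (fderiv ℂ g y) (x + (y - x)) := by
      rw [add_sub_cancel]
      exact (hg.differentiableAt (isOpen_ball.mem_nhds
        (hmem y (by linarith [hw1 y hy])))).hasFDerivAt
    have hgx : HasFDerivAt g (fderiv ℂ g x) x :=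
      (hg.differentiableAt (isOpen_ball.mem_nhds hx)).hasFDerivAt
    have h2 : HasFDerivAt G (fderiv ℂ g y - fderiv ℂ g x) x :=
      ((hasFDerivAt_comp_add_right (y - x)).2 hgy).sub hgx
    rwa [h2.fderiv] at h1
  rw [ContinuousAt, tendsto_iff_norm_sub_tendsto_zero]
  have hlim : Tendsto (fun y => 2 * (K * ‖y - x‖) / δ) (𝓝 x) (𝓝 0) := by
    have : Continuous (fun y => 2 * (K * ‖y - x‖) / δ) := by fun_prop
    simpa using this.tendsto x
  refine squeeze_zero' (Eventually.of_forall fun _ => norm_nonneg _) ?_ hlim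
  filter_upwards [ball_mem_nhds x hδ0] with y hy using hest y hy

/-! ### The group $e^{tA}$ -/

theorem exp_add_smul {𝔸 : Type*} [NormedRing 𝔸] [NormedAlgebra ℂ 𝔸] [CompleteSpace 𝔸] (a : 𝔸)
    (s t : ℂ) :
    NormedSpace.exp ((s + t) • a) = NormedSpace.exp (s • a) * NormedSpace.exp (t • a) := by
  let +nondep : NormedAlgebra ℚ 𝔸 := .restrictScalars ℚ ℂ 𝔸
  rw [← NormedSpace.exp_add_of_commute (((Commute.refl a).smul_left _).smul_right _), ← add_smul]

theorem continuous_exp_smul {𝔸 : Type*} [NormedRing 𝔸] [NormedAlgebra ℂ 𝔸] [CompleteSpace 𝔸]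
    (a : 𝔸) : Continuous fun t : ℂ => NormedSpace.exp (t • a) := by
  let +nondep : NormedAlgebra ℚ 𝔸 := .restrictScalars ℚ ℂ 𝔸
  exact NormedSpace.exp_continuous.comp (by fun_prop)

theorem expA_add (A : Cn n →L[ℂ] Cn n) (s t : ℝ) : expA A (s + t) = expA A s * expA A t := by
  unfold expA
  rw [Complex.ofReal_add]
  exact exp_add_smul A s t

theorem expA_zero (A : Cn n →L[ℂ] Cn n) : expA A 0 = 1 := by
  have h : ((0 : ℝ) : ℂ) • A = 0 := by rw [Complex.ofReal_zero]; exact zero_smul ℂ A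
  rw [expA, h, NormedSpace.exp_zero]

theorem expA_apply_expA_neg (A : Cn n →L[ℂ] Cn n) (t : ℝ) (x : Cn n) :
    expA A t (expA A (-t) x) = x := by
  rw [← mul_apply_eq_comp, ← expA_add, add_neg_cancel, expA_zero]
  rfl

theorem expA_neg_apply_expA (A : Cn n →L[ℂ] Cn n) (t : ℝ) (x : Cn n) :
    expA A (-t) (expA A t x) = x := by
  simpa using expA_apply_expA_neg A (-t) x

theorem continuous_expA (A : Cn n →L[ℂ] Cn n) : Continuous (expA A) :=
  (continuous_exp_smul A).comp Complex.continuous_ofReal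

/-! ### Constancy of the chain along the transition mappings -/

variable {A : Cn n →L[ℂ] Cn n} {h f : Cn n → ℝ → Cn n} {v : Cn n → ℝ → ℝ → Cn n}

theorem PolynomiallyBounded.exists_norm_le (hpoly : PolynomiallyBounded A f) {r : ℝ}
    (hr : r < 1) (T : ℝ) :
    ∃ B, 0 ≤ B ∧ ∀ z : Cn n, ‖z‖ ≤ r → ∀ t ∈ Icc 0 T, ‖f z t‖ ≤ B := by
  obtain ⟨C, P, hCP⟩ := hpoly (closedBall 0 r) (closedBall_subset_ball hr)
    (isCompact_closedBall _ _)
  obtain ⟨M, hM⟩ := (isCompact_Icc (a := 0) (b := T)).exists_bound_of_continuousOn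
    (f := fun t => ‖expA A t‖ * (C * P.eval t))
    (by have := continuous_expA A; have := P.continuous; fun_prop)
  refine ⟨max M 0, le_max_right _ _, fun z hz t ht => ?_⟩
  refine le_trans ?_ ((le_abs_self _).trans ((hM t ht).trans (le_max_left _ _)))
  rw [← expA_apply_expA_neg A t (f z t)]
  refine ((expA A t).le_opNorm _).trans ?_
  gcongr
  exact hCP z (by simpa using hz) t ht.1

theorem IsLoewnerSolution.absolutelyContinuousOnInterval (hf : IsLoewnerSolution h f) {z : Cn n}
    (hz : z ∈ unitBall n) {a b : ℝ} (ha : 0 ≤ a) (hab : a ≤ b) :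
    AbsolutelyContinuousOnInterval (f z) a b := by
  -- The endpoint `b + 1` is positive even when `b = 0`.
  have h1 : AbsolutelyContinuousOnInterval (f z) 0 (b + 1) := by
    rw [absolutelyContinuousOnInterval_iff]
    intro ε hε
    obtain ⟨δ, hδ, H⟩ := hf.ac {z} (by simpa using hz) isCompact_singleton (b + 1)
      (by linarith) ε hε
    exact ⟨δ, hδ, H z rfl⟩
  refine h1.mono ?_
  rw [uIcc_of_le hab, uIcc_of_le (by linarith)]
  exact Icc_subset_Icc ha (by linarith)

/-- The time derivative $Df\cdot h$ is bounded uniformly in $z$ and $t$, by a Cauchy estimate for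
$Df$ and `MemNA.norm_le` for $h$. The exceptional null set may vary with $z$ without affecting the
constant. -/
theorem IsLoewnerSolution.exists_time_lipschitz (hf : IsLoewnerSolution h f)
    (hA : 0 < lowerIndex A) (hh : IsGenerator A h) (hpoly : PolynomiallyBounded A f) {r : ℝ}
    (hr : r < 1) (T : ℝ) :
    ∃ M, 0 ≤ M ∧ ∀ z : Cn n, ‖z‖ ≤ r → ∀ a ∈ Icc 0 T, ∀ b ∈ Icc 0 T,
      ‖f z b - f z a‖ ≤ M * |b - a| := by
  set R := (1 + r) / 2 with hR
  have hrR : r < R := by rw [hR]; linarith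
  have hR1 : R < 1 := by rw [hR]; linarith
  obtain ⟨B, hB0, hB⟩ := hpoly.exists_norm_le hR1 T
  set H := (2 + 2 * ‖A‖) / ((1 - r) / 2) / ((1 - r) / 2)
  have hr1 : 0 < 1 - r := by linarith
  have hRr : 0 < R - r := by linarith
  refine ⟨2 * B / (R - r) * H, by positivity, fun z hz => ?_⟩
  have hzb : z ∈ unitBall n := by simpa using hz.trans_lt hr
  have hle : ∀ a ∈ Icc 0 T, ∀ b ∈ Icc 0 T, a ≤ b →
      ‖f z b - f z a‖ ≤ 2 * B / (R - r) * H * (b - a) := by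
    intro a ha b hb hab
    refine dist_le_of_ae_hasDerivAt_norm_le hab
      (hf.absolutelyContinuousOnInterval hzb ha.1 hab) ?_
    have h1 := hf.eqn z hzb
    rw [ae_restrict_iff' measurableSet_Ici] at h1
    filter_upwards [h1] with t ht hmem
    have ht0 : 0 ≤ t := ha.1.trans hmem.1
    refine ⟨_, ?_, ht ht0⟩
    refine (ContinuousLinearMap.le_opNorm _ _).trans ?_
    gcongr
    · refine norm_fderiv_le_of_norm_le ((hf.holo t ht0).mono (ball_subset_ball hR1.le))
        (fun x hx => hB x ?_ t ⟨ht0, hmem.2.trans hb.2⟩) hrR hz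
      exact (mem_ball_zero_iff.1 hx).le
    · exact (hh.mem t ht0).norm_le hA hr hz
  intro a ha b hb
  rcases le_total a b with hab | hab
  · rw [abs_of_nonneg (by linarith)]
    exact hle a ha b hb hab
  · rw [abs_of_nonpos (by linarith), norm_sub_rev, neg_sub]
    exact hle b hb a ha hab

theorem IsLoewnerSolution.exists_space_lipschitz (hf : IsLoewnerSolution h f)
    (hpoly : PolynomiallyBounded A f) {r : ℝ} (hr : r < 1) (T : ℝ) :
    ∃ L, 0 ≤ L ∧ ∀ t ∈ Icc 0 T, ∀ x y : Cn n, ‖x‖ ≤ r → ‖y‖ ≤ r →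
      ‖f x t - f y t‖ ≤ L * ‖x - y‖ := by
  have hrR : r < (1 + r) / 2 := by linarith
  have hR1 : (1 + r) / 2 < 1 := by linarith
  obtain ⟨B, hB0, hB⟩ := hpoly.exists_norm_le hR1 T
  refine ⟨2 * B / ((1 + r) / 2 - r), div_nonneg (by positivity) (by linarith),
    fun t ht x y hx hy => ?_⟩
  exact norm_sub_le_of_norm_le (g := fun z => f z t)
    ((hf.holo t ht.1).mono (ball_subset_ball hR1.le))
    (fun x hx => hB x (mem_ball_zero_iff.1 hx).le t ht) hrR hx hy

/-- The increment $f(\cdot,b)-f(\cdot,a)$ is holomorphic and $O(|b-a|)$ on a larger ball, so a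
Cauchy estimate gives the extra factor $\|x-y\|$. -/
theorem IsLoewnerSolution.exists_mixed_lipschitz (hf : IsLoewnerSolution h f)
    (hA : 0 < lowerIndex A) (hh : IsGenerator A h) (hpoly : PolynomiallyBounded A f) {r : ℝ}
    (hr : r < 1) (T : ℝ) :
    ∃ L, 0 ≤ L ∧ ∀ a ∈ Icc 0 T, ∀ b ∈ Icc 0 T, ∀ x y : Cn n, ‖x‖ ≤ r → ‖y‖ ≤ r →
      ‖(f x b - f x a) - (f y b - f y a)‖ ≤ L * |b - a| * ‖x - y‖ := by
  have hrR : r < (1 + r) / 2 := by linarith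
  have hR1 : (1 + r) / 2 < 1 := by linarith
  obtain ⟨M, hM0, hM⟩ := hf.exists_time_lipschitz hA hh hpoly hR1 T
  refine ⟨2 * M / ((1 + r) / 2 - r), div_nonneg (by positivity) (by linarith),
    fun a ha b hb x y hx hy => ?_⟩
  refine (norm_sub_le_of_norm_le (g := fun z => f z b - f z a) (B := M * |b - a|)
    (((hf.holo b hb.1).sub (hf.holo a ha.1)).mono (ball_subset_ball hR1.le))
    (fun x hx => hM x (mem_ball_zero_iff.1 hx).le a ha b hb) hrR hx hy).trans (le_of_eq ?_)
  ring

/-- Derivative of `τ ↦ f (v τ) τ`, when the derivative of `f` in the second variable is only known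
on a dense set, but the increments of `f` are equi-Lipschitz in the first variable. -/
theorem hasDerivAt_diagonal {g : Cn n → Cn n} {v : ℝ → Cn n} {v' : Cn n} {t L : ℝ}
    {U D : Set (Cn n)} (hU : U ∈ 𝓝 (v t)) (hD : Dense D) (hL : 0 ≤ L) (hv : HasDerivAt v v' t)
    (hft : DifferentiableAt ℂ (fun w => f w t) (v t))
    (hlip : ∀ᶠ τ in 𝓝 t, ∀ x ∈ U, ∀ y ∈ U,
      ‖(f x τ - f x t) - (f y τ - f y t)‖ ≤ L * |τ - t| * ‖x - y‖)
    (hg : ContinuousAt g (v t)) (hDg : ∀ w ∈ D ∩ U, HasDerivAt (f w) (g w) t) :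
    HasDerivAt (fun τ => f (v τ) τ) (fderiv ℂ (fun w => f w t) (v t) v' + g (v t)) t := by
  have h1 : HasDerivAt (fun τ => f (v τ) t) (fderiv ℂ (fun w => f w t) (v t) v') t :=
    (hft.hasFDerivAt.restrictScalars ℝ).comp_hasDerivAt t hv
  have h2 : HasDerivAt (fun τ => f (v τ) τ - f (v τ) t) (g (v t)) t := by
    rw [hasDerivAt_iff_isLittleO, Asymptotics.isLittleO_iff]
    intro ε hε
    set δ := ε / (3 * 2 * (L + 1)) with hδ
    have hδ0 : 0 < δ := by positivity
    -- A point `w` of `D` this close to `v t` costs at most $\varepsilon/3$ in each of two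
    -- replacements: `v τ` by `w` in the increment of `f`, and `g (v t)` by `g w`. The last third is
    -- the differentiability of `f w` at `t`.
    have hN : U ∩ {w | dist (g w) (g (v t)) < ε / 3} ∩ ball (v t) δ ∈ 𝓝 (v t) :=
      inter_mem (inter_mem hU (hg.eventually (ball_mem_nhds _ (by positivity))))
        (ball_mem_nhds _ hδ0)
    obtain ⟨w, hwD, ⟨hwU, hwg⟩, hwδ⟩ := (hD.inter_nhds_nonempty hN)
    have h3 := (hasDerivAt_iff_isLittleO.1 (hDg w ⟨hwD, hwU⟩))
    rw [Asymptotics.isLittleO_iff] at h3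
    filter_upwards [hlip, h3 (show 0 < ε / 3 by positivity), hv.continuousAt.eventually hU,
      hv.continuousAt.eventually (ball_mem_nhds _ hδ0)] with τ hτ1 hτ2 hτ3 hτ4
    have h4 := hτ1 _ hτ3 w hwU
    have h5 : ‖v τ - w‖ ≤ 2 * δ := by
      rw [← dist_eq_norm]
      have := dist_triangle_right (v τ) w (v t)
      rw [mem_ball] at hwδ
      linarith
    have h6 : L * |τ - t| * ‖v τ - w‖ ≤ ε / 3 * |τ - t| := by
      calc _ ≤ L * |τ - t| * (2 * δ) := by gcongr
        _ = |τ - t| * (L * (2 * δ)) := by ring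
        _ ≤ |τ - t| * ((L + 1) * (2 * δ)) := by gcongr; linarith
        _ = _ := by rw [hδ]; field_simp
    have h7 : ‖(τ - t) • (g w - g (v t))‖ ≤ |τ - t| * (ε / 3) := by
      rw [norm_smul, Real.norm_eq_abs]
      gcongr
      rw [← dist_eq_norm]; exact hwg.le
    rw [Real.norm_eq_abs] at hτ2 ⊢
    have h8 : f (v τ) τ - f (v τ) t - (f (v t) t - f (v t) t) - (τ - t) • g (v t) =
        ((f (v τ) τ - f (v τ) t) - (f w τ - f w t)) + (f w τ - f w t - (τ - t) • g w)
          + (τ - t) • (g w - g (v t)) := by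
      rw [smul_sub]; abel
    rw [h8]
    refine (norm_add₃_le).trans ?_
    linarith
  refine (h1.add h2).congr_of_eventuallyEq (Eventually.of_forall fun τ => ?_)
  simp

/-- Solutions of the Loewner equation are constant along the transition mappings. -/
theorem IsLoewnerSolution.apply_transition (hf : IsLoewnerSolution h f) (hA : 0 < lowerIndex A)
    (hh : IsGenerator A h) (hpoly : PolynomiallyBounded A f) (hv : IsTransitionMap h v)
    {z : Cn n} (hz : z ∈ unitBall n) {s T : ℝ} (hs : 0 ≤ s) (hsT : s ≤ T) :
    f (v z s T) T = f z s := by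
  have hr : ‖z‖ < 1 := by simpa using hz
  have hrR : ‖z‖ < (1 + ‖z‖) / 2 := by linarith
  have hR1 : (1 + ‖z‖) / 2 < 1 := by linarith
  obtain ⟨M, hM0, hM⟩ := hf.exists_time_lipschitz hA hh hpoly hr T
  obtain ⟨L, hL0, hL⟩ := hf.exists_space_lipschitz hpoly hr T
  -- The interval extends to `T + 1` so that it contains a neighbourhood of `t` even when `t = T`.
  obtain ⟨N, hN0, hN⟩ := hf.exists_mixed_lipschitz hA hh hpoly hR1 (T + 1)
  have hvz : ∀ t, s ≤ t → ‖v z s t‖ ≤ ‖z‖ := fun t ht => hv.norm_le hA hh hz hs ht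
  have hac : AbsolutelyContinuousOnInterval (fun τ => f (v z s τ) τ) s T := by
    refine absolutelyContinuousOnInterval_of_dist_le (L := L) (M := M) (hv.ac z hz s T hs hsT)
      fun x hx y hy => ?_
    rw [uIcc_of_le hsT] at hx hy
    have hx' : x ∈ Icc 0 T := ⟨hs.trans hx.1, hx.2⟩
    have hy' : y ∈ Icc 0 T := ⟨hs.trans hy.1, hy.2⟩
    refine (dist_triangle _ (f (v z s y) x) _).trans (add_le_add ?_ ?_)
    · rw [dist_eq_norm, dist_eq_norm]
      exact hL x hx' _ _ (hvz x hx.1) (hvz y hy.1)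
    · rw [dist_eq_norm, Real.dist_eq]
      exact hM _ (hvz y hy.1) y hy' x hx'
  obtain ⟨D, hDc, hDd⟩ := TopologicalSpace.exists_countable_dense (Cn n)
  have hDae : ∀ᵐ t, ∀ w ∈ D ∩ unitBall n, t ∈ Ici (0 : ℝ) →
      HasDerivAt (f w) (fderiv ℂ (fun x => f x t) w (h w t)) t := by
    rw [ae_ball_iff (hDc.mono inter_subset_left)]
    intro w hw
    rw [← ae_restrict_iff' measurableSet_Ici]
    exact hf.eqn w hw.2
  have hvae := hv.eqn z hz s hs
  rw [ae_restrict_iff' measurableSet_Ici] at hvae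
  obtain ⟨C, hC⟩ := hac.const_of_ae_hasDerivAt_zero (by
    -- Discarding `s` gives `t > 0`, so times close to `t` on either side are nonnegative.
    have hne : ∀ᵐ t : ℝ, t ≠ s := by simp [ae_iff]
    filter_upwards [hDae, hvae, hne] with t hDt hvt hts hmem
    rw [uIcc_of_le hsT] at hmem
    have hst : s < t := lt_of_le_of_ne hmem.1 (Ne.symm hts)
    have ht0 : 0 < t := hs.trans_lt hst
    have hvR : v z s t ∈ ball (0 : Cn n) ((1 + ‖z‖) / 2) := by
      rw [mem_ball_zero_iff]; linarith [hvz t hmem.1]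
    have hmemball := hv.mem_ball z hz s t hs hmem.1
    have hdiff := hf.holo t ht0.le
    have key := hasDerivAt_diagonal (f := f) (g := fun w => fderiv ℂ (fun x => f x t) w (h w t))
      (v := v z s) (v' := -h (v z s t) t) (t := t) (L := N)
      (U := ball (0 : Cn n) ((1 + ‖z‖) / 2)) (D := D) (isOpen_ball.mem_nhds hvR) hDd hN0
      (hvt hmem.1) (hdiff.differentiableAt (isOpen_ball.mem_nhds hmemball)) ?_ ?_ ?_
    · simpa using key
    · filter_upwards [Ioo_mem_nhds ht0 (show t < T + 1 by linarith [hmem.2])] with τ hτ x hx y hy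
      exact hN t ⟨ht0.le, by linarith [hmem.2]⟩ τ ⟨hτ.1.le, hτ.2.le⟩ x y
        (mem_ball_zero_iff.1 hx).le (mem_ball_zero_iff.1 hy).le
    · have h1 : ContinuousAt (fderiv ℂ (fun x => f x t)) (v z s t) :=
        continuousAt_fderiv hdiff hmemball
      have h2 : ContinuousAt (fun w => h w t) (v z s t) :=
        (hh.mem t ht0.le).holo.continuousOn.continuousAt (isOpen_ball.mem_nhds hmemball)
      exact h1.clm_apply h2
    · intro w hw
      exact hDt w ⟨hw.1, ball_subset_ball hR1.le hw.2⟩ ht0.le)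
  have h1 := hC T right_mem_uIcc
  have h2 := hC s left_mem_uIcc
  rw [h1, ← h2, hv.init z hz s hs]

end Invariance

/-! ### Exponential growth of $e^{tA}$ from the spectrum -/

section ExponentialGrowth

variable {E : Type*} [NormedAddCommGroup E] [NormedSpace ℂ E] [CompleteSpace E]

/-- On such `x` the exponential series is a polynomial in `t`, and $(ct)^j/j!\le e^{ct}$ absorbs
each term. -/
theorem norm_exp_smul_apply_le_of_pow_eq_zero (N : E →L[ℂ] E) {k : ℕ} {x : E}
    (hx : (N ^ k) x = 0) {c : ℝ} (hc : 0 < c) {t : ℝ} (ht : 0 ≤ t) :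
    ‖NormedSpace.exp ((t : ℂ) • N) x‖ ≤
      (∑ j ∈ Finset.range k, (c ^ j)⁻¹ * ‖(N ^ j) x‖) * Real.exp (c * t) := by
  have h1 : HasSum (fun j : ℕ => ((j.factorial : ℂ)⁻¹ • ((t : ℂ) • N) ^ j) x)
      (NormedSpace.exp ((t : ℂ) • N) x) :=
    (NormedSpace.exp_series_hasSum_exp' (𝕂 := ℂ) ((t : ℂ) • N)).mapL
      (ContinuousLinearMap.apply ℂ E x)
  have h2 : ∀ j : ℕ, ((j.factorial : ℂ)⁻¹ • ((t : ℂ) • N) ^ j) x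
      = ((j.factorial : ℂ)⁻¹ * (t : ℂ) ^ j) • (N ^ j) x := fun j => by
    rw [smul_pow, smul_smul]; rfl
  simp only [h2] at h1
  have h3 : ∀ j ∉ Finset.range k, ((j.factorial : ℂ)⁻¹ * (t : ℂ) ^ j) • (N ^ j) x = 0 := by
    intro j hj
    have : N ^ j = N ^ (j - k) * N ^ k := by
      rw [← pow_add]; congr 1; simp at hj; omega
    rw [this, mul_apply_eq_comp, hx, map_zero, smul_zero]
  rw [h1.unique (hasSum_sum_of_ne_finset_zero h3), Finset.sum_mul]
  refine (norm_sum_le _ _).trans (Finset.sum_le_sum fun j _ => ?_)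
  rw [norm_smul, norm_mul, norm_inv, norm_pow, Complex.norm_real, Real.norm_of_nonneg ht,
    Complex.norm_natCast]
  have h4 := Real.pow_div_factorial_le_exp (c * t) (by positivity) j
  calc _ = (c ^ j)⁻¹ * ‖(N ^ j) x‖ * ((c * t) ^ j / j.factorial) := by
        rw [mul_pow]; field_simp
    _ ≤ _ := by gcongr

/-- For an eigenvalue, $e^{tA}=e^{t\mu}e^{tN}$ with $N=A-\mu$, and $e^{tN}x$ is polynomial in `t`.
Off the spectrum $N$ is invertible and `x = 0`. -/
theorem exists_norm_exp_smul_apply_le (A : E →L[ℂ] E) {μ : ℂ} {κ : ℝ}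
    (hμ : μ ∈ spectrum ℂ A → μ.re < κ) {k : ℕ} {x : E}
    (hx : ((A - algebraMap ℂ (E →L[ℂ] E) μ) ^ k) x = 0) :
    ∃ C : ℝ, ∀ t : ℝ, 0 ≤ t → ‖NormedSpace.exp ((t : ℂ) • A) x‖ ≤ C * Real.exp (κ * t) := by
  set N := A - algebraMap ℂ (E →L[ℂ] E) μ with hN
  by_cases hmem : μ ∈ spectrum ℂ A
  · have hc : 0 < κ - μ.re := sub_pos.2 (hμ hmem)
    refine ⟨∑ j ∈ Finset.range k, ((κ - μ.re) ^ j)⁻¹ * ‖(N ^ j) x‖, fun t ht => ?_⟩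
    have h1 := norm_exp_smul_apply_le_of_pow_eq_zero N hx hc ht
    have h2 : NormedSpace.exp ((t : ℂ) • A) = Complex.exp (t * μ) • NormedSpace.exp ((t : ℂ) • N) := by
      let +nondep : NormedAlgebra ℚ (E →L[ℂ] E) := .restrictScalars ℚ ℂ _
      have h3 : (t : ℂ) • A = algebraMap ℂ (E →L[ℂ] E) (t * μ) + (t : ℂ) • N := by
        rw [hN, smul_sub, Algebra.smul_def _ (algebraMap ℂ (E →L[ℂ] E) μ), ← map_mul]
        abel
      rw [h3, NormedSpace.exp_add_of_commute (Algebra.commutes _ _),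
        ← NormedSpace.algebraMap_exp_comm, ← Complex.exp_eq_exp_ℂ, ← Algebra.smul_def]
    rw [h2, smul_apply, norm_smul, Complex.norm_exp]
    calc _ ≤ Real.exp ((t * μ).re) * (_ * Real.exp ((κ - μ.re) * t)) := by gcongr
      _ = (∑ j ∈ Finset.range k, ((κ - μ.re) ^ j)⁻¹ * ‖(N ^ j) x‖) *
          (Real.exp ((t * μ).re) * Real.exp ((κ - μ.re) * t)) := by ring
      _ = _ := by
        rw [← Real.exp_add, Complex.re_ofReal_mul]
        congr 2; ring
  · have hu : IsUnit N := by
      rw [spectrum.notMem_iff] at hmem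
      rw [hN, ← neg_sub]; exact hmem.neg
    obtain ⟨U, hU⟩ := hu.pow k
    have hx0 : x = 0 := by
      have : (↑U⁻¹ * ↑U : E →L[ℂ] E) x = 0 := by rw [mul_apply_eq_comp, hU, hx, map_zero]
      simpa using this
    exact ⟨0, fun t _ => by simp [hx0]⟩

/-- The vectors with the desired growth form a subspace containing all generalized eigenvectors,
hence everything; uniform boundedness turns the pointwise constants into one. -/
theorem exists_norm_exp_smul_le [FiniteDimensional ℂ E] (A : E →L[ℂ] E) {κ : ℝ}
    (hκ : ∀ μ ∈ spectrum ℂ A, μ.re < κ) :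
    ∃ C : ℝ, ∀ t : ℝ, 0 ≤ t → ‖NormedSpace.exp ((t : ℂ) • A)‖ ≤ C * Real.exp (κ * t) := by
  let S : Submodule ℂ E :=
    { carrier := {x | ∃ C : ℝ, ∀ t : ℝ, 0 ≤ t →
        ‖NormedSpace.exp ((t : ℂ) • A) x‖ ≤ C * Real.exp (κ * t)}
      zero_mem' := ⟨0, fun t _ => by simp⟩
      add_mem' := by
        rintro x y ⟨C, hC⟩ ⟨C', hC'⟩
        refine ⟨C + C', fun t ht => ?_⟩
        rw [map_add, add_mul]
        exact (norm_add_le _ _).trans (add_le_add (hC t ht) (hC' t ht))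
      smul_mem' := by
        rintro a x ⟨C, hC⟩
        refine ⟨‖a‖ * C, fun t ht => ?_⟩
        rw [map_smul, norm_smul, mul_assoc]
        gcongr
        exact hC t ht }
  have hS : S = ⊤ := by
    rw [eq_top_iff, ← Module.End.iSup_maxGenEigenspace_eq_top (A : E →ₗ[ℂ] E)]
    refine iSup_le fun μ x hx => ?_
    obtain ⟨k, hk⟩ := Module.End.mem_maxGenEigenspace _ _ _ |>.1 hx
    refine exists_norm_exp_smul_apply_le A (hκ μ) (k := k) ?_
    rw [← hk]
    have : ∀ j : ℕ, ∀ y : E, ((A - algebraMap ℂ (E →L[ℂ] E) μ) ^ j) y =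
        (((A : E →ₗ[ℂ] E) - μ • (1 : Module.End ℂ E)) ^ j) y := by
      intro j
      induction j with
      | zero => intro y; rfl
      | succ j ih =>
        intro y
        rw [pow_succ, pow_succ, mul_apply_eq_comp, Module.End.mul_apply, ih]
        congr 1
    exact this k x
  obtain ⟨C, hC⟩ := banach_steinhaus
    (g := fun t : {t : ℝ // 0 ≤ t} =>
      (Real.exp (-(κ * t)) : ℂ) • NormedSpace.exp (((t : ℝ) : ℂ) • A)) (by
    intro x
    obtain ⟨C, hC⟩ : x ∈ S := hS ▸ Submodule.mem_top
    refine ⟨C, fun t => ?_⟩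
    rw [smul_apply, norm_smul, Complex.norm_real, Real.norm_of_nonneg (Real.exp_pos _).le,
      Real.exp_neg, inv_mul_le_iff₀ (Real.exp_pos _), mul_comm]
    exact hC t t.2)
  refine ⟨C, fun t ht => ?_⟩
  have := hC ⟨t, ht⟩
  rwa [norm_smul, Complex.norm_real, Real.norm_of_nonneg (Real.exp_pos _).le,
      Real.exp_neg, inv_mul_le_iff₀ (Real.exp_pos _), mul_comm] at this

theorem exists_norm_expA_le {n : ℕ} (A : Cn n →L[ℂ] Cn n) {κ : ℝ} (hκ : upperIndex A < κ) :
    ∃ C : ℝ, ∀ t : ℝ, 0 ≤ t → ‖expA A t‖ ≤ C * Real.exp (κ * t) := by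
  refine exists_norm_exp_smul_le A fun μ hμ => lt_of_le_of_lt ?_ hκ
  exact le_csSup ((spectrum.isCompact A).image Complex.continuous_re).bddAbove ⟨μ, hμ, rfl⟩

end ExponentialGrowth

/-! ### Tails of homogeneous expansions -/

section Tail

open scoped ENNReal NNReal in
/-- Cauchy estimates for the coefficients of a convergent power series. -/
theorem norm_coeff_le_of_hasSum {E : Type*} [NormedAddCommGroup E] [NormedSpace ℂ E]
    [CompleteSpace E] {a : ℕ → E} {g : ℂ → E}
    (hg : ∀ ζ ∈ ball (0 : ℂ) 1, HasSum (fun k => ζ ^ k • a k) (g ζ)) {R M : ℝ} (hR : 0 < R)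
    (hR1 : R < 1) (hM : ∀ ζ ∈ sphere (0 : ℂ) R, ‖g ζ‖ ≤ M) (k : ℕ) : ‖a k‖ ≤ M / R ^ k := by
  set p : FormalMultilinearSeries ℂ ℂ E := fun k => ContinuousMultilinearMap.mkPiRing ℂ (Fin k) (a k)
    with hp
  have hrad : (1 : ℝ≥0∞) ≤ p.radius := by
    refine ENNReal.le_of_forall_nnreal_lt fun r hr => ?_
    have hr1 : r < 1 := by exact_mod_cast hr
    refine p.le_radius_of_tendsto (l := 0) ?_
    have h1 := (hg (r : ℂ) (by simpa using hr1)).summable.tendsto_atTop_zero.norm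
    rw [norm_zero] at h1
    refine h1.congr fun k => ?_
    rw [norm_smul, norm_pow, hp, ContinuousMultilinearMap.norm_mkPiRing, mul_comm]
    simp
  have hps : HasFPowerSeriesOnBall g p 0 1 :=
    { r_le := hrad
      r_pos := one_pos
      hasSum := by
        intro ζ hζ
        have hζ' : ζ ∈ ball (0 : ℂ) 1 := by
          rwa [← ENNReal.ofReal_one, Metric.eball_ofReal] at hζ
        have := hg ζ hζ'
        simpa [hp, zero_add] using this }
  have h1 : (k.factorial : ℂ) • a k = iteratedDeriv k g 0 := by
    have := hps.factorial_smul 1 k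
    rw [iteratedDeriv_eq_iteratedFDeriv, ← this, hp]
    simp [Nat.cast_smul_eq_nsmul]
  have hd : DifferentiableOn ℂ g (ball 0 1) := by
    have := hps.differentiableOn
    rwa [← ENNReal.ofReal_one, Metric.eball_ofReal] at this
  have h2 := Complex.norm_iteratedDeriv_le_of_forall_mem_sphere_norm_le k hR
    (DifferentiableOn.diffContOnCl (by
      rw [closure_ball _ hR.ne']; exact hd.mono (closedBall_subset_ball hR1))) hM
  rw [← h1, norm_smul, Complex.norm_natCast, mul_div_assoc] at h2
  exact le_of_mul_le_mul_left h2 (by positivity)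

/-- On the complex line through `z` the expansion is a power series in one variable. Cauchy
estimates on the circle of radius $1/2$ bound its terms by $M(2\|z\|)^k$, and $2\|z\|\le 1/2$ makes
the geometric tail at most twice its first term. -/
theorem norm_tail_le {G : Cn n → Cn n}
    {F : (k : ℕ) → ContinuousMultilinearMap ℂ (fun _ : Fin k => Cn n) (Cn n)}
    (hG : ∀ z ∈ unitBall n, Summable (fun k : ℕ => F (k + 2) (fun _ => z)) ∧
      G z = z + ∑' k : ℕ, F (k + 2) (fun _ => z)) {M : ℝ}
    (hM : ∀ z : Cn n, ‖z‖ ≤ 1 / 2 → ‖G z‖ ≤ M) {z : Cn n} (hz : ‖z‖ ≤ 1 / 4) (N : ℕ) :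
    ‖G z - (z + ∑ k ∈ Finset.Icc 2 N, F k (fun _ => z))‖ ≤ 2 * M * (2 * ‖z‖) ^ (N + 1) := by
  rcases eq_or_ne z 0 with rfl | hz0
  · have h1 : ∀ k : ℕ, 2 ≤ k → F k (fun _ => (0 : Cn n)) = 0 := fun k hk =>
      (F k).map_coord_zero (⟨0, by omega⟩ : Fin k) rfl
    have h2 : ∀ k : ℕ, F (k + 2) (fun _ => (0 : Cn n)) = 0 := fun k => h1 _ (by omega)
    rw [(hG 0 (by simp)).2, Finset.sum_eq_zero fun k hk => h1 k (Finset.mem_Icc.1 hk).1]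
    simp [h2]
  obtain ⟨u, hu, hzu⟩ := exists_unit_smul hz0
  have hM0 : 0 ≤ M := (norm_nonneg _).trans (hM 0 (by simp))
  set a : ℕ → Cn n := fun k => if k = 0 then 0 else if k = 1 then u else F k (fun _ => u) with ha
  have ha2 : ∀ k, 2 ≤ k → ∀ ζ : ℂ, ζ ^ k • a k = F k (fun _ => ζ • u) := fun k hk ζ => by
    have h1 := (F k).map_smul_univ (fun _ => ζ) (fun _ => u)
    rw [h1, Fin.prod_const, ha]
    simp only [show k ≠ 0 by omega, show k ≠ 1 by omega, if_false]
  have ha1 : ∀ ζ : ℂ, ∑ k ∈ Finset.range 2, ζ ^ k • a k = ζ • u := fun ζ => by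
    simp [Finset.sum_range_succ, ha]
  have hsum : ∀ ζ ∈ ball (0 : ℂ) 1, HasSum (fun k => ζ ^ k • a k) (G (ζ • u)) := by
    intro ζ hζ
    obtain ⟨h1, h2⟩ := hG (ζ • u) (by simpa [norm_smul, hu] using hζ)
    rw [h2, add_comm, ← hasSum_nat_add_iff' 2, ha1, add_sub_cancel_right]
    refine h1.hasSum.congr_fun fun k => ?_
    exact ha2 (k + 2) (by omega) ζ
  have hcoef : ∀ k, ‖a k‖ ≤ M / (1 / 2) ^ k := fun k =>
    norm_coeff_le_of_hasSum hsum (by norm_num) (by norm_num)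
      (fun ζ hζ => hM _ (by
        have : ‖ζ‖ = 1 / 2 := by simpa using hζ
        rw [norm_smul, hu, this, mul_one])) k
  set x := 2 * ‖z‖ with hx
  have hx0 : 0 ≤ x := by positivity
  have hx1 : x ≤ 1 / 2 := by rw [hx]; linarith
  set b : ℕ → Cn n := fun k => (‖z‖ : ℂ) ^ k • a k with hb
  have hbn : ∀ k, ‖b k‖ ≤ M * x ^ k := fun k => by
    rw [hb, norm_smul, norm_pow, Complex.norm_real, norm_norm]
    calc _ ≤ ‖z‖ ^ k * (M / (1 / 2) ^ k) := by gcongr; exact hcoef k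
      _ = _ := by rw [hx, mul_pow, one_div, inv_pow]; field_simp
  have hbs : HasSum b (G z) := by
    have := hsum (‖z‖ : ℂ) (by simp; linarith)
    rwa [← hzu] at this
  have htail : ∀ K : ℕ, ‖G z - ∑ k ∈ Finset.range K, b k‖ ≤ 2 * M * x ^ K := fun K => by
    have h1 := (hasSum_nat_add_iff' K).2 hbs
    have h2 : HasSum (fun k : ℕ => M * x ^ K * x ^ k) (M * x ^ K * (1 - x)⁻¹) :=
      (hasSum_geometric_of_lt_one hx0 (by linarith)).mul_left _
    refine (h1.norm_le_of_bounded h2 fun k => ?_).trans ?_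
    · refine (hbn _).trans (le_of_eq ?_); rw [pow_add]; ring
    · have : (1 - x)⁻¹ ≤ 2 := by
        rw [inv_le_comm₀ (by linarith) (by norm_num)]; linarith
      calc _ ≤ M * x ^ K * 2 := by gcongr
        _ = _ := by ring
  -- The maximum matters when `N = 0`: the linear term is always part of the sum.
  have hpart : z + ∑ k ∈ Finset.Icc 2 N, F k (fun _ => z)
      = ∑ k ∈ Finset.range (max 2 (N + 1)), b k := by
    rw [← Finset.sum_range_add_sum_Ico _ (le_max_left 2 (N + 1)), hb, ha1, ← hzu]
    have : Finset.Ico 2 (max 2 (N + 1)) = Finset.Icc 2 N := by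
      ext k; simp; omega
    rw [this]
    congr 1
    refine Finset.sum_congr rfl fun k hk => ?_
    exact (by rw [ha2 k (Finset.mem_Icc.1 hk).1, ← hzu] : (‖z‖ : ℂ) ^ k • a k = _).symm
  rw [hpart]
  refine (htail _).trans ?_
  gcongr 2 * M * ?_
  exact pow_le_pow_of_le_one hx0 (by linarith) (le_max_right _ _)

end Tail

/-! ### Combination of the growth rates -/

theorem tendsto_polynomial_eval_mul_exp_neg (P : Polynomial ℝ) {γ : ℝ} (hγ : 0 < γ) :
    Tendsto (fun t => P.eval t * Real.exp (-(γ * t))) atTop (𝓝 0) := by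
  have h1 := (P.comp (Polynomial.C γ⁻¹ * Polynomial.X)).tendsto_div_exp_atTop.comp
    (tendsto_id.const_mul_atTop hγ)
  refine h1.congr fun t => ?_
  simp [Polynomial.eval_comp, inv_mul_cancel_left₀ hγ.ne', Real.exp_neg, div_eq_mul_inv]

end Loewner
open Loewner
theorem mainTheorem5 {n : ℕ} (A : Cn n →L[ℂ] Cn n) (hA : 0 < lowerIndex A)
    (h : Cn n → ℝ → Cn n) (hh : IsGenerator A h)
    (v : Cn n → ℝ → ℝ → Cn n) (hv : IsTransitionMap h v)
    (f : Cn n → ℝ → Cn n) (hf : IsLoewnerSolution h f) (hpoly : PolynomiallyBounded A f)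
    (F : (k : ℕ) → ℝ → ContinuousMultilinearMap ℂ (fun _ : Fin k => Cn n) (Cn n))
    (hF : HasExpansion A f F) (s : ℝ) (hs : 0 ≤ s) :
    TendstoLocallyUniformlyOn
      (fun (t : ℝ) (z : Cn n) =>
        expA A t (v z s t + ∑ k ∈ Finset.Icc 2 (criticalOrder A), F k t (fun _ => v z s t)))
      (fun z => f z s) atTop (unitBall n) := by
  rw [Metric.tendstoLocallyUniformlyOn_iff]
  intro ε hε x hx
  have hx1 : ‖x‖ < 1 := by simpa using hx
  set r := (1 + ‖x‖) / 2 with hr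
  have hxr : ‖x‖ < r := by rw [hr]; linarith
  have hr1 : r < 1 := by rw [hr]; linarith
  refine ⟨ball 0 r, mem_nhdsWithin_of_mem_nhds (isOpen_ball.mem_nhds (by simpa using hxr)), ?_⟩
  set m := lowerIndex A with hm
  set N := criticalOrder A with hN
  -- The only property of $n_0$ that is needed; being strict, it leaves room for $\kappa$.
  have hNm : upperIndex A < m * (N + 1) := by
    have h1 : upperIndex A / m < N + 1 := Nat.lt_floor_add_one _
    rwa [div_lt_iff₀ hA, mul_comm] at h1
  obtain ⟨κ, hκ1, hκ2⟩ := exists_between hNm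
  obtain ⟨C₁, hC₁⟩ := exists_norm_expA_le A hκ1
  obtain ⟨C₂, P, hP⟩ := hpoly (closedBall 0 (1 / 2)) (closedBall_subset_ball (by norm_num))
    (isCompact_closedBall _ _)
  set e := Real.exp (2 / ((1 - r) / (1 + r))) with he
  have hdecay : ∀ z ∈ ball (0 : Cn n) r, ∀ t, s ≤ t →
      ‖v z s t‖ ≤ e * Real.exp (-(m * (t - s))) := fun z hz t ht =>
    hv.norm_le_exp hA hh hr1 (mem_ball_zero_iff.1 hz).le hs ht
  have hbound : ∀ᶠ t : ℝ in atTop, 2 * C₁ * C₂ * (2 * e * Real.exp (m * s)) ^ (N + 1) *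
      (P.eval t * Real.exp (-((m * (N + 1) - κ) * t))) < ε := by
    have := (tendsto_polynomial_eval_mul_exp_neg P (sub_pos.2 hκ2)).const_mul
      (2 * C₁ * C₂ * (2 * e * Real.exp (m * s)) ^ (N + 1))
    rw [mul_zero] at this
    exact this.eventually (gt_mem_nhds hε)
  have hsmall : ∀ᶠ t : ℝ in atTop, e * Real.exp (-(m * (t - s))) < 1 / 4 := by
    have h1 : Tendsto (fun t : ℝ => m * (t - s)) atTop atTop :=
      (tendsto_atTop_add_const_right _ (-s) tendsto_id).const_mul_atTop hA
    have h2 := (Real.tendsto_exp_neg_atTop_nhds_zero.comp h1).const_mul e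
    rw [mul_zero] at h2
    exact h2.eventually (gt_mem_nhds (by norm_num))
  filter_upwards [hbound, hsmall, eventually_ge_atTop s] with t ht1 ht2 hst z hz
  have ht0 : 0 ≤ t := hs.trans hst
  have hzb : z ∈ unitBall n := ball_subset_ball hr1.le hz
  set w := v z s t with hw
  have hwd := hdecay z hz t hst
  have hGbd : ∀ y : Cn n, ‖y‖ ≤ 1 / 2 → ‖expA A (-t) (f y t)‖ ≤ C₂ * P.eval t := fun y hy =>
    hP y (by simpa using hy) t ht0
  have hM0 : 0 ≤ C₂ * P.eval t := (norm_nonneg _).trans (hGbd 0 (by simp))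
  have htail := norm_tail_le (G := fun y => expA A (-t) (f y t)) (F := fun k => F k t)
    (fun y hy => ⟨(hF y hy t ht0).1, by rw [(hF y hy t ht0).2, expA_neg_apply_expA]⟩)
    hGbd (z := w) (by linarith) N
  -- With $f(z,s)$ replaced by $f(v,t)=e^{tA}e^{-tA}f(v,t)$, the error is $e^{tA}$ of the tail at
  -- $w=v(z,s,t)$.
  rw [← hf.apply_transition hA hh hpoly hv hzb hs hst, dist_eq_norm,
    ← expA_apply_expA_neg A t (f (v z s t) t), ← map_sub]
  refine lt_of_le_of_lt ?_ ht1
  have hC₁0 : 0 ≤ C₁ * Real.exp (κ * t) := (norm_nonneg _).trans (hC₁ t ht0)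
  calc _ ≤ ‖expA A t‖ * _ := (expA A t).le_opNorm _
    _ ≤ C₁ * Real.exp (κ * t) * (2 * (C₂ * P.eval t) * (2 * ‖w‖) ^ (N + 1)) :=
        mul_le_mul (hC₁ t ht0) htail (norm_nonneg _) hC₁0
    _ ≤ C₁ * Real.exp (κ * t) *
        (2 * (C₂ * P.eval t) * (2 * (e * Real.exp (-(m * (t - s))))) ^ (N + 1)) := by gcongr
    _ = _ := by
        have h1 : Real.exp (-(m * (t - s))) = Real.exp (m * s) * Real.exp (-(m * t)) := by
          rw [← Real.exp_add]; congr 1; ring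
        have h2 : Real.exp (-((m * (N + 1) - κ) * t))
            = Real.exp (κ * t) * Real.exp (-(m * t)) ^ (N + 1) := by
          rw [← Real.exp_nat_mul, ← Real.exp_add]; congr 1; push_cast; ring
        rw [h1, h2, show 2 * (e * (Real.exp (m * s) * Real.exp (-(m * t))))
          = (2 * e * Real.exp (m * s)) * Real.exp (-(m * t)) by ring, mul_pow]
        ring
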